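/- Let $\mathbb T$ be the unit circle with normalized Lebesgue measure, let $H^2\subset L^2(\mathbb T)$ be the closed subspace of functions whose negative Fourier coefficients vanish, identified with the Hardy space of the unit disk, and let $H_0^2=zH^2$. An inner function is a $\theta\in H^2$ with $|\theta|=1$ almost everywhere on $\mathbb T$. For inner $\theta$ put $K_\theta=H^2\ominus\theta H^2$, let $P_\theta$ be the orthogonal projection of $L^2(\mathbb T)$ onto $K_\theta$, let $K_\theta^\perp=L^2(\mathbb T)\ominus K_\theta=\overline{H_0^2}\oplus\theta H^2$, and let $U_\theta:K_\theta^\perp\to K_\theta^\perp$, $U_\theta h=(I-P_\theta)(zh)$. A closed subspace $\mathcal M\subseteq K_\theta^\perp$ is nearly $U_\theta^*$-invariant if $U_\theta^*(\mathcal M\cap U_\theta K_\theta^\perp)\subseteq\mathcal M$. Corollary 2.4. Let $\theta$ be an inner function with $\theta(0)\neq0$. Let $\mathcal M$ be a nearly $U_\theta^*$-invariant subspace of $K_\theta^\perp$ which is non-trivial, that is, $\mathcal M\ne\{0\}$ and $\mathcal M\ne K_\theta^\perp$, and which is of the form $\mathcal M=\mathcal M_-\oplus\mathcal M_+$, where $\mathcal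 M_-$ is a closed subspace of $\overline{H_0^2}$ and $\mathcal M_+$ is a closed subspace of $\theta H^2$. Then there is an inner function $\gamma$ with $\mathcal M=\theta K_\gamma\oplus\overline{H_0^2}$, or there is an inner function $\alpha$ with $\mathcal M=\overline{\alpha H_0^2}$. -/

import Mathlib

open MeasureTheory AddCircle Filter
open scoped ENNReal

noncomputable section

namespace DualShift

/-- `L²(𝕋)` with respect to normalized Lebesgue measure. The circle `𝕋` is parametrized by
`ℝ / ℤ` through `t ↦ exp (2 π i t)`, so that `fourier n` is the function `zⁿ` and
`fourierCoeff f n` is the `n`-th Fourier coefficient. -/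
abbrev L2T : Type := Lp ℂ 2 (haarAddCircle : Measure UnitAddCircle)

/-- The closed subspace of all `f ∈ L²(𝕋)` whose Fourier coefficients of index `< k` vanish. -/
def coeffVanishBelow (k : ℤ) : Submodule ℂ L2T where
  carrier := {f | ∀ n : ℤ, n < k → fourierCoeff f n = 0}
  zero_mem' := by
    intro n _
    rw [← fourierBasis_repr, map_zero]
    rfl
  add_mem' := by
    intro f g hf hg n hn
    have h1 := hf n hn
    have h2 := hg n hn
    rw [← fourierBasis_repr] at h1 h2 ⊢
    rw [map_add, lp.coeFn_add, Pi.add_apply, h1, h2, add_zero]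
  smul_mem' := by
    intro c f hf n hn
    have h1 := hf n hn
    rw [← fourierBasis_repr] at h1 ⊢
    rw [map_smul, lp.coeFn_smul, Pi.smul_apply, h1, smul_zero]

/-- The Hardy space `H²`, as a subspace of `L²(𝕋)`: negative Fourier coefficients vanish. -/
def hardy : Submodule ℂ L2T := coeffVanishBelow 0

/-- `H₀² = z H²`, the functions of `H²` whose mean (that is, value at the origin) is zero. -/
def hardy0 : Submodule ℂ L2T := coeffVanishBelow 1

/-- The function `∑ₙ aₙ zⁿ` on the unit disk that corresponds to the element of `H²` with
Fourier coefficients `aₙ`. -/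
def diskFun (f : L2T) (z : ℂ) : ℂ := ∑' n : ℕ, fourierCoeff f (n : ℤ) * z ^ n

/-- Inner functions, given by their boundary functions: elements of `H²` of modulus one almost
everywhere on the circle. -/
def IsInner (θ : L2T) : Prop :=
  θ ∈ hardy ∧ ∀ᵐ t ∂(haarAddCircle : Measure UnitAddCircle), ‖θ t‖ = 1

/-- `θ V = {θ g : g ∈ V}`, as a subspace of `L²(𝕋)`. -/
def mulSub (θ : L2T) (V : Submodule ℂ L2T) : Submodule ℂ L2T where
  carrier := {f | ∃ g ∈ V, ⇑f =ᵐ[haarAddCircle] fun t => θ t * g t}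
  zero_mem' := by
    refine ⟨0, V.zero_mem, ?_⟩
    filter_upwards [Lp.coeFn_zero ℂ 2 (haarAddCircle : Measure UnitAddCircle)] with t ht
    simp [ht]
  add_mem' := by
    rintro f₁ f₂ ⟨g₁, h₁, e₁⟩ ⟨g₂, h₂, e₂⟩
    refine ⟨g₁ + g₂, V.add_mem h₁ h₂, ?_⟩
    filter_upwards [e₁, e₂, Lp.coeFn_add f₁ f₂, Lp.coeFn_add g₁ g₂] with t a b c d
    rw [c, d, Pi.add_apply, Pi.add_apply, a, b, mul_add]
  smul_mem' := by
    rintro c f ⟨g, h, e⟩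
    refine ⟨c • g, V.smul_mem c h, ?_⟩
    filter_upwards [e, Lp.coeFn_smul c f, Lp.coeFn_smul c g] with t a b d
    rw [b, d, Pi.smul_apply, Pi.smul_apply, a, smul_eq_mul, smul_eq_mul]
    ring

/-- The space `{conj g : g ∈ V}` of complex conjugates of the functions in `V`. -/
def conjSub (V : Submodule ℂ L2T) : Submodule ℂ L2T where
  carrier := {f | ∃ g ∈ V, ⇑f =ᵐ[haarAddCircle] fun t => (starRingEnd ℂ) (g t)}
  zero_mem' := by
    refine ⟨0, V.zero_mem, ?_⟩
    filter_upwards [Lp.coeFn_zero ℂ 2 (haarAddCircle : Measure UnitAddCircle)] with t ht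
    simp [ht]
  add_mem' := by
    rintro f₁ f₂ ⟨g₁, h₁, e₁⟩ ⟨g₂, h₂, e₂⟩
    refine ⟨g₁ + g₂, V.add_mem h₁ h₂, ?_⟩
    filter_upwards [e₁, e₂, Lp.coeFn_add f₁ f₂, Lp.coeFn_add g₁ g₂] with t a b c d
    rw [c, d, Pi.add_apply, Pi.add_apply, a, b, map_add]
  smul_mem' := by
    rintro c f ⟨g, h, e⟩
    refine ⟨(starRingEnd ℂ) c • g, V.smul_mem _ h, ?_⟩
    filter_upwards [e, Lp.coeFn_smul c f, Lp.coeFn_smul ((starRingEnd ℂ) c) g] with t a b d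
    rw [b, d, Pi.smul_apply, Pi.smul_apply, a, smul_eq_mul, smul_eq_mul, map_mul,
      Complex.conj_conj]

/-- The model space `K_θ = H² ⊖ θ H²`. -/
def modelSpace (θ : L2T) : Submodule ℂ L2T := hardy ⊓ (mulSub θ hardy)ᗮ

/-- Multiplication by `z` (the bilateral shift) on `L²(𝕋)`. -/
def mulZ : L2T →L[ℂ] L2T :=
  ContinuousLinearMap.holderL (haarAddCircle : Measure UnitAddCircle) ∞ 2 2
    (ContinuousLinearMap.mul ℂ ℂ) (fourierLp ∞ 1)

/-- The dual compressed shift `U_θ h = (I - P_θ) (z h)` on `K_θ^⊥`; here `I - P_θ` is the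
orthogonal projection of `L²(𝕋)` onto `K_θ^⊥`. -/
def dualShift (θ : L2T) : (modelSpace θ)ᗮ →L[ℂ] (modelSpace θ)ᗮ :=
  (modelSpace θ)ᗮ.orthogonalProjectionOnto ∘L mulZ ∘L (modelSpace θ)ᗮ.subtypeL

/-- A closed subspace `F` of a Hilbert space `E` is nearly `T`-invariant if
`T (F ∩ T^* E) ⊆ F`. -/
def IsNearlyInvariant {E : Type*} [NormedAddCommGroup E] [InnerProductSpace ℂ E]
    [CompleteSpace E] (T : E →L[ℂ] E) (F : Submodule ℂ E) : Prop :=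
  IsClosed (F : Set E) ∧
    ∀ f ∈ F, f ∈ Set.range (ContinuousLinearMap.adjoint T) → T f ∈ F

/-- `M = A ⊕ B` as an orthogonal direct sum of subspaces of `L²(𝕋)`. -/
def IsOrthSum (M A B : Submodule ℂ L2T) : Prop := A ⟂ B ∧ M = A ⊔ B

end DualShift

end

/-! Since `θ(0) ≠ 0`, the operator `U_θ` is onto (`dualShift_surjective`), so near invariance under
`U_θ^*` is plain invariance. On `\overline{H_0^2}` the operator `U_θ^*` is multiplication by `z̄`,
while `U_θ^*(θ g) = θ S^*g + g(0) θ(0) z̄`, where `S^*g = z̄ (g - g(0))` is the backward shift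
(`adjoint_dualShift_of_mem_mulSub`).

Put `N = {g : θ g ∈ M_+}`. Comparing components in `M_- ⊕ M_+` shows that `M_-` is `z̄`-invariant,
that `N` is `S^*`-invariant, and that `g(0) θ(0) z̄ ∈ M_-` for every `g ∈ N`. If `g(0) = 0`
throughout `N`, iterating `S^*` kills every Taylor coefficient, so `N = 0` and `M = M_-`;
conjugation and Beurling's theorem give `α`. Otherwise `z̄ ∈ M_-`, hence `M_- = \overline{H_0^2}`;
then `N ≠ H²` because `M` is proper, and Beurling's theorem for `H² ⊖ N` gives `N = K_γ`. Beurling's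
theorem itself (`exists_isInner_eq_mulSub_hardy`) comes from a unit vector of `P ⊖ zP`. -/

noncomputable section

namespace DualShift

open scoped InnerProductSpace

/-! ### Multiplication by unimodular functions and by powers of `z`. -/

/-- Elements of `L²(𝕋)` of modulus one almost everywhere. -/
def Unimodular (θ : L2T) : Prop :=
  ∀ᵐ t ∂(haarAddCircle : Measure UnitAddCircle), ‖θ t‖ = 1

lemma memLp_unimodular_mul {θ : L2T} (hθ : Unimodular θ) (f : L2T) :
    MemLp (fun t => θ t * f t) 2 (haarAddCircle : Measure UnitAddCircle) := by
  refine (Lp.memLp f).of_le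
    ((Lp.aestronglyMeasurable θ).mul (Lp.aestronglyMeasurable f)) ?_
  filter_upwards [hθ] with t ht
  simp [ht]

/-- Multiplication by a unimodular function, as an isometry of `L²(𝕋)`. -/
def unimodularMul {θ : L2T} (hθ : Unimodular θ) : L2T →ₗᵢ[ℂ] L2T where
  toFun f := (memLp_unimodular_mul hθ f).toLp _
  map_add' f g := by
    refine Lp.ext ?_
    filter_upwards [(memLp_unimodular_mul hθ (f + g)).coeFn_toLp,
      (memLp_unimodular_mul hθ f).coeFn_toLp, (memLp_unimodular_mul hθ g).coeFn_toLp,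
      Lp.coeFn_add ((memLp_unimodular_mul hθ f).toLp _) ((memLp_unimodular_mul hθ g).toLp _),
      Lp.coeFn_add f g] with t h1 h2 h3 h4 h5
    rw [h1, h4, Pi.add_apply, h2, h3, h5, Pi.add_apply, mul_add]
  map_smul' c f := by
    refine Lp.ext ?_
    filter_upwards [(memLp_unimodular_mul hθ (c • f)).coeFn_toLp,
      (memLp_unimodular_mul hθ f).coeFn_toLp,
      Lp.coeFn_smul c ((memLp_unimodular_mul hθ f).toLp _),
      Lp.coeFn_smul c f] with t h1 h2 h4 h5
    rw [RingHom.id_apply, h1, h4, Pi.smul_apply, h2, h5, Pi.smul_apply, smul_eq_mul, smul_eq_mul]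
    ring
  norm_map' f := by
    change ‖(memLp_unimodular_mul hθ f).toLp _‖ = ‖f‖
    rw [Lp.norm_toLp, Lp.norm_def]
    congr 1
    refine eLpNorm_congr_norm_ae ?_
    filter_upwards [hθ] with t ht
    simp [ht]

lemma coeFn_unimodularMul {θ : L2T} (hθ : Unimodular θ) (f : L2T) :
    ⇑(unimodularMul hθ f) =ᵐ[haarAddCircle] fun t => θ t * f t :=
  (memLp_unimodular_mul hθ f).coeFn_toLp

lemma eq_unimodularMul_iff {θ : L2T} (hθ : Unimodular θ) {f g : L2T} :
    f = unimodularMul hθ g ↔ ⇑f =ᵐ[haarAddCircle] fun t => θ t * g t :=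
  ⟨fun h => h ▸ coeFn_unimodularMul hθ g, fun h => Lp.ext (h.trans (coeFn_unimodularMul hθ g).symm)⟩

lemma mem_mulSub_iff {θ : L2T} (hθ : Unimodular θ) {V : Submodule ℂ L2T} {f : L2T} :
    f ∈ mulSub θ V ↔ ∃ g ∈ V, unimodularMul hθ g = f := by
  refine exists_congr fun g => and_congr_right fun _ => ?_
  rw [eq_comm, eq_unimodularMul_iff]

lemma mulSub_eq_map {θ : L2T} (hθ : Unimodular θ) (V : Submodule ℂ L2T) :
    mulSub θ V = V.map (unimodularMul hθ).toLinearMap := by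
  ext f
  rw [mem_mulSub_iff hθ, Submodule.mem_map]
  rfl

lemma unimodular_fourierLp (n : ℤ) : Unimodular (fourierLp 2 n) := by
  filter_upwards [coeFn_fourierLp (T := 1) 2 n] with t ht
  rw [ht, fourier_apply, Circle.norm_coe]

/-- Multiplication by `zⁿ` on `L²(𝕋)`. -/
def zMul (n : ℤ) : L2T →ₗᵢ[ℂ] L2T := unimodularMul (unimodular_fourierLp n)

lemma coeFn_zMul (n : ℤ) (f : L2T) :
    ⇑(zMul n f) =ᵐ[haarAddCircle] fun t => fourier n t * f t := by
  filter_upwards [coeFn_unimodularMul (unimodular_fourierLp n) f,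
    coeFn_fourierLp (T := 1) 2 n] with t h1 h2
  rw [zMul, h1, h2]

lemma zMul_zMul (m n : ℤ) (f : L2T) : zMul m (zMul n f) = zMul (m + n) f := by
  refine Lp.ext ?_
  filter_upwards [coeFn_zMul m (zMul n f), coeFn_zMul n f, coeFn_zMul (m + n) f] with t h1 h2 h3
  rw [h1, h2, h3, fourier_add, mul_assoc]

lemma zMul_zero (f : L2T) : zMul 0 f = f := by
  refine Lp.ext ?_
  filter_upwards [coeFn_zMul 0 f] with t h1
  rw [h1, fourier_zero, one_mul]

lemma zMul_fourierLp (m n : ℤ) : zMul m (fourierLp 2 n) = fourierLp 2 (m + n) := by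
  refine Lp.ext ?_
  filter_upwards [coeFn_zMul m (fourierLp 2 n), coeFn_fourierLp (T := 1) 2 n,
    coeFn_fourierLp (T := 1) 2 (m + n)] with t h1 h2 h3
  rw [h1, h2, h3, fourier_add]

lemma unimodularMul_zMul {θ : L2T} (hθ : Unimodular θ) (n : ℤ) (f : L2T) :
    unimodularMul hθ (zMul n f) = zMul n (unimodularMul hθ f) := by
  refine Lp.ext ?_
  filter_upwards [coeFn_unimodularMul hθ f, coeFn_unimodularMul hθ (zMul n f), coeFn_zMul n f,
    coeFn_zMul n (unimodularMul hθ f)] with t h1 h2 h3 h4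
  rw [h2, h4, h1, h3]
  ring

lemma unimodularMul_fourierLp {θ : L2T} (hθ : Unimodular θ) (n : ℤ) :
    unimodularMul hθ (fourierLp 2 n) = zMul n θ := by
  refine Lp.ext ?_
  filter_upwards [coeFn_unimodularMul hθ (fourierLp 2 n), coeFn_fourierLp (T := 1) 2 n,
    coeFn_zMul n θ] with t h1 h2 h3
  rw [h1, h2, h3, mul_comm]

lemma inner_zMul_left (n : ℤ) (f g : L2T) : ⟪zMul n f, g⟫_ℂ = ⟪f, zMul (-n) g⟫_ℂ := by
  rw [← (zMul (-n)).inner_map_map, zMul_zMul, neg_add_cancel, zMul_zero]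

/-! ### Fourier coefficients, conjugation and the Hardy space. -/

lemma fourierCoeff_eq_inner (f : L2T) (n : ℤ) :
    fourierCoeff f n = ⟪(fourierLp 2 n : L2T), f⟫_ℂ := by
  rw [← fourierBasis_repr, HilbertBasis.repr_apply_apply, coe_fourierBasis]

lemma fourierCoeff_zMul (m n : ℤ) (f : L2T) :
    fourierCoeff (zMul m f) n = fourierCoeff f (n - m) := by
  rw [fourierCoeff_eq_inner, fourierCoeff_eq_inner, ← (zMul m).inner_map_map (fourierLp 2 (n - m)),
    zMul_fourierLp, add_sub_cancel]

lemma fourierCoeff_fourierLp (m n : ℤ) :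
    fourierCoeff (fourierLp 2 m : L2T) n = if n = m then 1 else 0 := by
  rw [fourierCoeff_eq_inner, orthonormal_iff_ite.mp orthonormal_fourier]

lemma fourierCoeff_sub (f g : L2T) (n : ℤ) :
    fourierCoeff (f - g : L2T) n = fourierCoeff f n - fourierCoeff g n := by
  simp only [fourierCoeff_eq_inner, inner_sub_right]

lemma fourierCoeff_smul (c : ℂ) (f : L2T) (n : ℤ) :
    fourierCoeff (c • f : L2T) n = c * fourierCoeff f n := by
  simp only [fourierCoeff_eq_inner, inner_smul_right]

lemma eq_zero_of_fourierCoeff {f : L2T} (h : ∀ n : ℤ, fourierCoeff f n = 0) : f = 0 := by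
  have hs := hasSum_fourier_series_L2 f
  simp only [h, zero_smul] at hs
  exact hs.unique hasSum_zero

lemma fourierCoeff_star (f : L2T) (n : ℤ) :
    fourierCoeff (star f : L2T) n = (starRingEnd ℂ) (fourierCoeff f (-n)) := by
  rw [fourierCoeff_congr_ae (Lp.coeFn_star f)]
  simp only [fourierCoeff, ← integral_conj]
  refine integral_congr_ae (ae_of_all _ fun t => ?_)
  simp

lemma mem_conjSub_iff {V : Submodule ℂ L2T} {f : L2T} : f ∈ conjSub V ↔ star f ∈ V := by
  constructor
  · rintro ⟨g, hg, h⟩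
    convert hg
    refine Lp.ext ?_
    filter_upwards [h, Lp.coeFn_star f] with t h1 h2
    rw [h2, Pi.star_apply, h1]
    simp
  · intro h
    refine ⟨star f, h, ?_⟩
    filter_upwards [Lp.coeFn_star f] with t h2
    rw [h2, Pi.star_apply]
    simp

lemma mem_conjSub_hardy0_iff {f : L2T} :
    f ∈ conjSub hardy0 ↔ ∀ n : ℤ, 0 ≤ n → fourierCoeff f n = 0 := by
  rw [mem_conjSub_iff]
  change (∀ n : ℤ, n < 1 → _) ↔ _
  simp only [fourierCoeff_star, map_eq_zero]
  exact ⟨fun h n hn => by simpa using h (-n) (by omega), fun h n hn => h _ (by omega)⟩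

/-- The partial Fourier sums lie in `V` and converge to `f`. This reduces later membership proofs to
monomials. -/
lemma mem_of_forall_fourierLp_mem {V : Submodule ℂ L2T} (hV : IsClosed (V : Set L2T)) {f : L2T}
    (h : ∀ n : ℤ, fourierCoeff f n ≠ 0 → (fourierLp 2 n : L2T) ∈ V) : f ∈ V := by
  refine hV.mem_of_tendsto (hasSum_fourier_series_L2 f) (Eventually.of_forall fun s => ?_)
  refine V.sum_mem fun n _ => ?_
  by_cases hn : fourierCoeff f n = 0
  · rw [hn, zero_smul]
    exact V.zero_mem
  · exact V.smul_mem _ (h n hn)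

lemma continuous_fourierCoeff (n : ℤ) : Continuous fun f : L2T => fourierCoeff f n := by
  simp only [fourierCoeff_eq_inner]
  fun_prop

lemma isClosed_coeffVanishBelow (k : ℤ) : IsClosed (coeffVanishBelow k : Set L2T) := by
  have : (coeffVanishBelow k : Set L2T) = ⋂ n : ℤ, ⋂ _ : n < k,
      {f : L2T | fourierCoeff f n = 0} := by
    ext f
    simp [coeffVanishBelow]
  rw [this]
  exact isClosed_iInter fun n => isClosed_iInter fun _ =>
    isClosed_eq (continuous_fourierCoeff n) continuous_const

instance : CompleteSpace hardy := (isClosed_coeffVanishBelow 0).completeSpace_coe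

lemma hardy_orthogonal : hardyᗮ = conjSub hardy0 := by
  ext f
  rw [mem_conjSub_hardy0_iff, Submodule.mem_orthogonal]
  constructor
  · intro h n hn
    rw [fourierCoeff_eq_inner]
    refine h _ fun m hm => ?_
    rw [fourierCoeff_fourierLp, if_neg (by omega)]
  · intro h u hu
    -- Orthogonality to `f` is membership in a closed subspace, so it can be tested on the monomials
    -- occurring in `u`.
    suffices u ∈ (ℂ ∙ f)ᗮ from Submodule.mem_orthogonal_singleton_iff_inner_left.mp this
    refine mem_of_forall_fourierLp_mem (Submodule.isClosed_orthogonal _) fun n hn => ?_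
    rw [Submodule.mem_orthogonal_singleton_iff_inner_left, ← fourierCoeff_eq_inner]
    exact h n (by by_contra hc; exact hn (hu n (by omega)))

lemma zMul_mem_hardy {f : L2T} (hf : f ∈ hardy) {n : ℤ} (hn : 0 ≤ n) : zMul n f ∈ hardy := by
  intro m hm
  rw [fourierCoeff_zMul]
  exact hf _ (by omega)

lemma zMul_mem_conjSub {f : L2T} (hf : f ∈ conjSub hardy0) {n : ℤ} (hn : n ≤ 0) :
    zMul n f ∈ conjSub hardy0 := by
  rw [mem_conjSub_hardy0_iff] at hf ⊢
  intro m hm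
  rw [fourierCoeff_zMul]
  exact hf _ (by omega)

/-- The preimage of `H²` under multiplication by `θ` is closed and contains `zⁿ` for `n ≥ 0`,
because `zⁿ θ ∈ H²`. -/
lemma unimodularMul_mem_hardy {θ : L2T} (hθ : Unimodular θ) (h : θ ∈ hardy) {f : L2T}
    (hf : f ∈ hardy) : unimodularMul hθ f ∈ hardy := by
  refine mem_of_forall_fourierLp_mem (V := hardy.comap (unimodularMul hθ).toLinearMap)
    ((isClosed_coeffVanishBelow 0).preimage (unimodularMul hθ).continuous) fun n hn => ?_
  change unimodularMul hθ (fourierLp 2 n) ∈ hardy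
  rw [unimodularMul_fourierLp]
  exact zMul_mem_hardy h (by by_contra hc; exact hn (hf n (by omega)))

lemma mulZ_eq (f : L2T) : mulZ f = zMul 1 f := by
  refine Lp.ext ?_
  filter_upwards [(ContinuousLinearMap.mul ℂ ℂ).coeFn_holder (r := 2)
    (fourierLp ∞ 1 : Lp ℂ ∞ (haarAddCircle : Measure UnitAddCircle)) f,
    coeFn_fourierLp (T := 1) ∞ 1, coeFn_zMul 1 f] with t h1 h2 h3
  rw [h3, ← h2]
  exact h1

/-! ### Beurling's theorem. -/

/-- Multiplication by a continuous function, depending continuously and linearly on it, applied to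
a fixed element of `L²(𝕋)`. -/
def continuousMul (φ : L2T) : C(UnitAddCircle, ℂ) →L[ℂ] L2T :=
  (ContinuousLinearMap.holderL (haarAddCircle : Measure UnitAddCircle) ∞ 2 2
    (ContinuousLinearMap.mul ℂ ℂ)).flip φ ∘L
      ContinuousMap.toLp ∞ (haarAddCircle : Measure UnitAddCircle) ℂ

lemma coeFn_continuousMul (φ : L2T) (p : C(UnitAddCircle, ℂ)) :
    ⇑(continuousMul φ p) =ᵐ[haarAddCircle] fun t => p t * φ t := by
  filter_upwards [(ContinuousLinearMap.mul ℂ ℂ).coeFn_holder (r := 2)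
    (ContinuousMap.toLp ∞ (haarAddCircle : Measure UnitAddCircle) ℂ p) φ,
    ContinuousMap.coeFn_toLp (p := ∞) (𝕜 := ℂ) (haarAddCircle : Measure UnitAddCircle) p]
    with t h1 h2
  rw [← h2]
  exact h1

lemma continuousMul_fourier (φ : L2T) (n : ℤ) : continuousMul φ (fourier n) = zMul n φ := by
  refine Lp.ext ?_
  filter_upwards [coeFn_continuousMul φ (fourier n), coeFn_zMul n φ] with t h1 h2
  rw [h1, h2]

lemma inner_continuousMul (φ : L2T) (p : C(UnitAddCircle, ℂ)) :
    ⟪φ, continuousMul φ p⟫_ℂ =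
      ∫ t, ((‖φ t‖ ^ 2 : ℝ) : ℂ) * p t ∂(haarAddCircle : Measure UnitAddCircle) := by
  rw [L2.inner_def]
  refine integral_congr_ae ?_
  filter_upwards [coeFn_continuousMul φ p] with t h
  rw [h, RCLike.inner_apply, mul_assoc, Complex.mul_conj, Complex.normSq_eq_norm_sq, mul_comm]

/-- If `φ` has norm one and is orthogonal to `zⁿ φ` for all `n ≠ 0`, then `|φ| = 1` almost
everywhere: the Fourier coefficients of `|φ|²` are those of the constant function `1`. -/
lemma unimodular_of_inner_zMul {φ : L2T} (hφ : ‖φ‖ = 1)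
    (h : ∀ n : ℤ, n ≠ 0 → ⟪φ, zMul n φ⟫_ℂ = 0) : Unimodular φ := by
  -- The functionals `p ↦ ∫ |φ|² p` and `p ↦ ∫ p` are continuous on `C(𝕋)` and agree on monomials,
  -- whose span is dense.
  have key : (innerSL ℂ φ) ∘L continuousMul φ =
      (innerSL ℂ (fourierLp 2 0 : L2T)) ∘L continuousMul (fourierLp 2 0) := by
    refine ContinuousLinearMap.ext_on (s := Set.range fourier) ?_ ?_
    · rw [dense_iff_closure_eq, ← Submodule.topologicalClosure_coe, span_fourier_closure_eq_top]
      rfl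
    · rintro _ ⟨n, rfl⟩
      simp only [ContinuousLinearMap.comp_apply, continuousMul_fourier, innerSL_apply_apply]
      rw [zMul_fourierLp, add_zero, ← fourierCoeff_eq_inner, fourierCoeff_fourierLp]
      rcases eq_or_ne n 0 with rfl | hn
      · rw [zMul_zero, inner_self_eq_norm_sq_to_K, hφ]
        simp
      · rw [h n hn, if_neg hn.symm]
  have hnorm : ∀ᵐ t ∂(haarAddCircle : Measure UnitAddCircle), ‖(fourierLp 2 0 : L2T) t‖ = 1 :=
    unimodular_fourierLp 0
  have hint : ∀ p : C(UnitAddCircle, ℂ),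
      ∫ t, ((‖φ t‖ ^ 2 : ℝ) : ℂ) * p t ∂(haarAddCircle : Measure UnitAddCircle) =
        ∫ t, p t ∂(haarAddCircle : Measure UnitAddCircle) := by
    intro p
    rw [← inner_continuousMul]
    refine (DFunLike.congr_fun key p).trans ?_
    simp only [ContinuousLinearMap.comp_apply, innerSL_apply_apply]
    rw [inner_continuousMul]
    refine integral_congr_ae ?_
    filter_upwards [hnorm] with t ht
    rw [ht]
    simp
  have hmeas : AEMeasurable (fun t => ‖φ t‖₊ ^ 2) (haarAddCircle : Measure UnitAddCircle) :=
    (Lp.aestronglyMeasurable φ).aemeasurable.nnnorm.pow_const 2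
  have hfin : ∫⁻ t, ((‖φ t‖₊ ^ 2 : NNReal) : ℝ≥0∞) ∂(haarAddCircle : Measure UnitAddCircle) ≠ ∞ := by
    have := (Lp.memLp φ).integrable_norm_pow (by norm_num)
    have h2 := this.hasFiniteIntegral.ne
    simpa [enorm_eq_nnnorm] using h2
  have : IsFiniteMeasure ((haarAddCircle : Measure UnitAddCircle).withDensity
      fun t => ((‖φ t‖₊ ^ 2 : NNReal) : ℝ≥0∞)) := isFiniteMeasure_withDensity hfin
  -- Finite measures with equal integrals of continuous functions coincide, and then so do their
  -- densities almost everywhere.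
  have hμ : (haarAddCircle : Measure UnitAddCircle).withDensity
      (fun t => ((‖φ t‖₊ ^ 2 : NNReal) : ℝ≥0∞)) =
      (haarAddCircle : Measure UnitAddCircle).withDensity 1 := by
    rw [withDensity_one]
    refine ext_of_forall_integral_eq_of_IsFiniteMeasure fun f => ?_
    rw [integral_withDensity_eq_integral_smul₀ hmeas]
    have := hint ⟨fun t => (f t : ℂ), by fun_prop⟩
    simp only [ContinuousMap.coe_mk] at this
    rw [← Complex.ofReal_inj, ← integral_complex_ofReal, ← integral_complex_ofReal, ← this]
    refine integral_congr_ae (ae_of_all _ fun t => ?_)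
    simp [NNReal.smul_def]
  rw [withDensity_eq_iff hmeas.coe_nnreal_ennreal measurable_one.aemeasurable hfin] at hμ
  filter_upwards [hμ] with t ht
  have h1 : ‖φ t‖₊ ^ 2 = 1 := by
    rw [Pi.one_apply] at ht
    exact_mod_cast ht
  have h2 : ‖φ t‖ ^ 2 = 1 := by
    rw [← coe_nnnorm]
    exact_mod_cast h1
  rwa [pow_eq_one_iff_of_nonneg (norm_nonneg _) two_ne_zero] at h2

lemma Unimodular.star {φ : L2T} (h : Unimodular φ) : Unimodular (star φ) := by
  filter_upwards [h, Lp.coeFn_star φ] with t h1 h2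
  rw [h2, Pi.star_apply, norm_star, h1]

lemma unimodularMul_star {φ : L2T} (h : Unimodular φ) (f : L2T) :
    unimodularMul h (unimodularMul h.star f) = f := by
  refine Lp.ext ?_
  filter_upwards [h, Lp.coeFn_star φ, coeFn_unimodularMul h.star f,
    coeFn_unimodularMul h (unimodularMul h.star f)] with t h1 h2 h3 h4
  rw [h4, h3, h2, Pi.star_apply, ← mul_assoc, ← starRingEnd_apply, Complex.mul_conj,
    Complex.normSq_eq_norm_sq, h1]
  simp

/-- The inner products with `zⁿ φ` are the Fourier coefficients of `φ̄ g`. -/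
lemma eq_zero_of_inner_zMul {φ g : L2T} (h : Unimodular φ) (hg : ∀ n : ℤ, ⟪zMul n φ, g⟫_ℂ = 0) :
    g = 0 := by
  have : unimodularMul h.star g = 0 := by
    refine eq_zero_of_fourierCoeff fun n => ?_
    rw [fourierCoeff_eq_inner, ← (unimodularMul h).inner_map_map, unimodularMul_star,
      unimodularMul_fourierLp, hg]
  exact (map_eq_zero_iff _ (unimodularMul h.star).injective).mp this

/-- **Beurling's theorem**: a nonzero closed shift-invariant subspace of `H²` is of the form
`φ H²` with `φ` inner. -/
theorem exists_isInner_eq_mulSub_hardy {P : Submodule ℂ L2T} (hP : IsClosed (P : Set L2T))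
    (hle : P ≤ hardy) (hz : ∀ f ∈ P, zMul 1 f ∈ P) (hne : P ≠ ⊥) :
    ∃ φ : L2T, IsInner φ ∧ P = mulSub φ hardy := by
  have : CompleteSpace P := hP.completeSpace_coe
  set Q := P.map (zMul 1).toLinearMap with hQ
  have : CompleteSpace Q := (zMul 1).completeSpace_map P
  have hQP : Q ≤ P := by
    rintro _ ⟨f, hf, rfl⟩
    exact hz f hf
  have hsup := Submodule.sup_orthogonal_inf_of_hasOrthogonalProjection hQP
  -- If `P = zP`, every element of `P` can be divided by `z` indefinitely within `P ⊆ H²`, so all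
  -- its coefficients vanish.
  have hW : Qᗮ ⊓ P ≠ ⊥ := by
    intro hbot
    rw [hbot, sup_bot_eq] at hsup
    refine hne ((Submodule.eq_bot_iff _).mpr fun f hf => eq_zero_of_fourierCoeff fun n => ?_)
    rcases lt_or_ge n 0 with hn | hn
    · exact hle hf n hn
    · lift n to ℕ using hn
      induction n generalizing f with
      | zero =>
        obtain ⟨g, hg, rfl⟩ := hsup.ge hf
        exact (fourierCoeff_zMul 1 0 g).trans (hle hg _ (by norm_num))
      | succ n ih =>
        obtain ⟨g, hg, rfl⟩ := hsup.ge hf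
        refine (fourierCoeff_zMul 1 _ g).trans ?_
        push_cast
        rw [add_sub_cancel_right]
        exact ih g hg
  obtain ⟨ψ, hψ, hψ0⟩ := Submodule.exists_mem_ne_zero_of_ne_bot hW
  have hψ0' : ((‖ψ‖ : ℂ)⁻¹) ≠ 0 := by simpa using hψ0
  obtain ⟨φ, hφ, hφ1⟩ : ∃ φ ∈ Qᗮ ⊓ P, ‖φ‖ = 1 :=
    ⟨(‖ψ‖ : ℂ)⁻¹ • ψ, Submodule.smul_mem _ _ hψ, by
      rw [norm_smul, norm_inv, Complex.norm_real, norm_norm,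
        inv_mul_cancel₀ (norm_ne_zero_iff.mpr hψ0)]⟩
  have horth : ∀ g ∈ P, ⟪zMul 1 g, φ⟫_ℂ = 0 := fun g hg =>
    (Submodule.mem_orthogonal _ _).mp hφ.1 _ ⟨g, hg, rfl⟩
  have hpow : ∀ g ∈ P, ∀ n : ℕ, zMul n g ∈ P := by
    intro g hg n
    induction n with
    | zero => simpa [zMul_zero] using hg
    | succ n ih =>
      have := hz _ ih
      rw [zMul_zMul, add_comm] at this
      exact_mod_cast this
  have horth' : ∀ g ∈ P, ∀ n : ℤ, 0 < n → ⟪zMul n g, φ⟫_ℂ = 0 := by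
    intro g hg n hn
    have := horth _ (hpow g hg (n - 1).toNat)
    rwa [zMul_zMul, Int.toNat_of_nonneg (by omega), add_sub_cancel] at this
  -- For `n > 0`, `zⁿ φ ∈ zP` is orthogonal to `φ`; negative `n` follow by moving the power to the
  -- other side.
  have huni : Unimodular φ := by
    refine unimodular_of_inner_zMul hφ1 fun n hn => ?_
    rcases lt_or_gt_of_ne hn with hn | hn
    · have := horth' φ hφ.2 (-n) (by omega)
      rwa [inner_zMul_left, neg_neg] at this
    · exact inner_eq_zero_symm.mp (horth' φ hφ.2 n hn)
  refine ⟨φ, ⟨hle hφ.2, huni⟩, ?_⟩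
  rw [mulSub_eq_map huni]
  set R := hardy.map (unimodularMul huni).toLinearMap with hR
  have : CompleteSpace R := (unimodularMul huni).completeSpace_map hardy
  have hRP : R ≤ P := by
    rintro _ ⟨f, hf, rfl⟩
    refine mem_of_forall_fourierLp_mem (V := P.comap (unimodularMul huni).toLinearMap)
      (hP.preimage (unimodularMul huni).continuous) fun n hn => ?_
    change unimodularMul huni (fourierLp 2 n) ∈ P
    rw [unimodularMul_fourierLp]
    have hn0 : 0 ≤ n := by
      by_contra hc
      exact hn (hf n (by omega))
    lift n to ℕ using hn0
    exact hpow φ hφ.2 n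
  rw [← Submodule.sup_orthogonal_inf_of_hasOrthogonalProjection hRP]
  suffices Rᗮ ⊓ P = ⊥ by rw [this, sup_bot_eq]
  refine (Submodule.eq_bot_iff _).mpr fun g hg => eq_zero_of_inner_zMul huni fun n => ?_
  -- For `n < 0`, use `φ ⟂ z^{-n} g ∈ zP`; for `n ≥ 0`, use `zⁿ φ ∈ φH²`, to which `g` is
  -- orthogonal.
  rcases lt_or_ge n 0 with hn | hn
  · rw [inner_zMul_left, inner_eq_zero_symm]
    exact horth' g hg.2 _ (by omega)
  · refine (Submodule.mem_orthogonal _ _).mp hg.1 _ ⟨fourierLp 2 n, fun m hm => ?_, ?_⟩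
    · rw [fourierCoeff_fourierLp, if_neg (by omega)]
    · exact unimodularMul_fourierLp huni n

/-! ### The decomposition of `K_θ^⊥`. -/

lemma IsInner.mem_hardy {θ : L2T} (hθ : IsInner θ) : θ ∈ hardy := hθ.1

lemma IsInner.unimodular {θ : L2T} (hθ : IsInner θ) : Unimodular θ := hθ.2

lemma conjSub_hardy0_le (θ : L2T) : conjSub hardy0 ≤ (modelSpace θ)ᗮ :=
  hardy_orthogonal.symm.le.trans (Submodule.orthogonal_le inf_le_left)

lemma mulSub_hardy_le_orthogonal (θ : L2T) : mulSub θ hardy ≤ (modelSpace θ)ᗮ :=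
  (Submodule.le_orthogonal_orthogonal _).trans (Submodule.orthogonal_le inf_le_right)

lemma IsInner.mulSub_hardy_le {θ : L2T} (hθ : IsInner θ) : mulSub θ hardy ≤ hardy := by
  intro f hf
  obtain ⟨g, hg, rfl⟩ := (mem_mulSub_iff hθ.unimodular).mp hf
  exact unimodularMul_mem_hardy hθ.unimodular hθ.mem_hardy hg

lemma IsInner.mulSub_hardy_isOrtho {θ : L2T} (hθ : IsInner θ) :
    mulSub θ hardy ⟂ conjSub hardy0 := by
  rw [← hardy_orthogonal]
  exact (Submodule.isOrtho_orthogonal_right hardy).mono_left hθ.mulSub_hardy_le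

/-- Split `x` along `H²` and its complement, then the `H²` part along `θH²`. The remainder lies in
both `K_θ` and `K_θ^⊥`, so it is zero. -/
lemma IsInner.orthogonal_modelSpace {θ : L2T} (hθ : IsInner θ) :
    (modelSpace θ)ᗮ = conjSub hardy0 ⊔ mulSub θ hardy := by
  refine le_antisymm (fun x hx => ?_)
    (sup_le (conjSub_hardy0_le θ) (mulSub_hardy_le_orthogonal θ))
  have : CompleteSpace (mulSub θ hardy) := by
    rw [mulSub_eq_map hθ.unimodular]
    exact (unimodularMul hθ.unimodular).completeSpace_map hardy
  obtain ⟨p, hp, q, hq, rfl⟩ := Submodule.exists_add_mem_mem_orthogonal (K := hardy) x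
  rw [hardy_orthogonal] at hq
  have hp' : p ∈ (modelSpace θ)ᗮ := by
    simpa using Submodule.sub_mem _ hx (conjSub_hardy0_le θ hq)
  obtain ⟨r, hr, s, hs, rfl⟩ := Submodule.exists_add_mem_mem_orthogonal (K := mulSub θ hardy) p
  have hs1 : s ∈ modelSpace θ :=
    ⟨by simpa using Submodule.sub_mem _ hp (hθ.mulSub_hardy_le hr), hs⟩
  have hs2 : s ∈ (modelSpace θ)ᗮ := by
    simpa using Submodule.sub_mem _ hp' (mulSub_hardy_le_orthogonal θ hr)
  have hs0 : s = 0 := by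
    have := Submodule.mem_inf.mpr ⟨hs1, hs2⟩
    rwa [Submodule.inf_orthogonal_eq_bot] at this
  rw [hs0, add_zero, add_comm]
  exact Submodule.add_mem_sup hq hr

/-! ### The dual shift, its adjoint and the backward shift. -/

lemma dualShift_eq {θ : L2T} {h w : (modelSpace θ)ᗮ} {r : L2T} (hr : r ∈ modelSpace θ)
    (hw : zMul 1 (h : L2T) = w + r) : dualShift θ h = w := by
  change (modelSpace θ)ᗮ.orthogonalProjectionOnto (mulZ (h : L2T)) = w
  rw [mulZ_eq, hw, map_add, Submodule.orthogonalProjectionOnto_mem_subspace_eq_self,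
    Submodule.orthogonalProjectionOnto_apply_of_mem_orthogonal
      (Submodule.le_orthogonal_orthogonal _ hr), add_zero]

/-- The adjoint is multiplication by `z̄` followed by projection onto `K_θ^⊥`, so any `K_θ` summand
`r` drops out. -/
lemma adjoint_dualShift_eq {θ : L2T} {h w : (modelSpace θ)ᗮ} {r : L2T} (hr : r ∈ modelSpace θ)
    (hw : zMul (-1) (h : L2T) = w + r) : ContinuousLinearMap.adjoint (dualShift θ) h = w := by
  refine ext_inner_right ℂ fun k => ?_
  rw [ContinuousLinearMap.adjoint_inner_left]
  change ⟪h, (modelSpace θ)ᗮ.orthogonalProjectionOnto (mulZ (k : L2T))⟫_ℂ = _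
  rw [Submodule.inner_orthogonalProjectionOnto_eq_of_mem_left, mulZ_eq, Submodule.coe_inner,
    ← inner_conj_symm, inner_zMul_left, hw, inner_conj_symm, inner_add_left,
    (Submodule.mem_orthogonal _ _).mp k.2 _ hr, add_zero]

/-- The backward shift `g ↦ z̄ (g - ĝ(0))`. -/
def backwardShift (g : L2T) : L2T := zMul (-1) (g - fourierCoeff g 0 • fourierLp 2 0)

lemma zMul_neg_one_eq (g : L2T) :
    zMul (-1) g = backwardShift g + fourierCoeff g 0 • fourierLp 2 (-1) := by
  rw [backwardShift, map_sub, map_smul, zMul_fourierLp, add_zero, sub_add_cancel]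

lemma eq_zMul_backwardShift (g : L2T) :
    g = zMul 1 (backwardShift g) + fourierCoeff g 0 • fourierLp 2 0 := by
  rw [backwardShift, zMul_zMul, add_neg_cancel, zMul_zero, sub_add_cancel]

lemma fourierCoeff_backwardShift {g : L2T} {n : ℤ} (hn : n ≠ -1) :
    fourierCoeff (backwardShift g) n = fourierCoeff g (n + 1) := by
  rw [backwardShift, fourierCoeff_zMul, fourierCoeff_sub, fourierCoeff_smul,
    fourierCoeff_fourierLp, if_neg (by omega), mul_zero, sub_zero, sub_neg_eq_add]

lemma backwardShift_mem_hardy {g : L2T} (hg : g ∈ hardy) : backwardShift g ∈ hardy := by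
  intro n hn
  rcases eq_or_ne n (-1) with rfl | h
  · rw [backwardShift, fourierCoeff_zMul, fourierCoeff_sub, fourierCoeff_smul,
      fourierCoeff_fourierLp]
    simp
  · rw [fourierCoeff_backwardShift h]
    exact hg _ (by omega)

lemma fourierLp_mem_hardy {n : ℤ} (hn : 0 ≤ n) : (fourierLp 2 n : L2T) ∈ hardy := by
  intro m hm
  rw [fourierCoeff_fourierLp, if_neg (by omega)]

lemma fourierLp_mem_conjSub {n : ℤ} (hn : n < 0) : (fourierLp 2 n : L2T) ∈ conjSub hardy0 := by
  rw [mem_conjSub_hardy0_iff]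
  intro m hm
  rw [fourierCoeff_fourierLp, if_neg (by omega)]

lemma mem_modelSpace_iff {θ : L2T} (hθ : Unimodular θ) {f : L2T} :
    f ∈ modelSpace θ ↔ f ∈ hardy ∧ ∀ g ∈ hardy, ⟪unimodularMul hθ g, f⟫_ℂ = 0 := by
  refine and_congr_right fun _ => ?_
  change f ∈ (mulSub θ hardy)ᗮ ↔ _
  rw [mulSub_eq_map hθ, Submodule.mem_orthogonal]
  exact ⟨fun h g hg => h _ ⟨g, hg, rfl⟩, by rintro h _ ⟨g, hg, rfl⟩; exact h g hg⟩

/-- Write `S^*θ = θ z̄ - θ(0) z̄`. Against `θ g`, the first term gives `⟨g, z̄⟩ = 0` and the second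
a multiple of `⟨θ g, z̄⟩ = 0`. -/
lemma backwardShift_mem_modelSpace {θ : L2T} (hθ : IsInner θ) :
    backwardShift θ ∈ modelSpace θ := by
  refine (mem_modelSpace_iff hθ.unimodular).mpr ⟨backwardShift_mem_hardy hθ.mem_hardy, fun g hg => ?_⟩
  have h1 : backwardShift θ = unimodularMul hθ.unimodular (fourierLp 2 (-1))
      - fourierCoeff θ 0 • fourierLp 2 (-1) := by
    rw [unimodularMul_fourierLp, zMul_neg_one_eq, add_sub_cancel_right]
  rw [h1, inner_sub_right, LinearIsometry.inner_map_map, inner_smul_right,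
    inner_eq_zero_symm.mp ((fourierCoeff_eq_inner _ _).symm.trans (hg (-1) (by norm_num))),
    inner_eq_zero_symm.mp ((fourierCoeff_eq_inner _ _).symm.trans
      (unimodularMul_mem_hardy hθ.unimodular hθ.mem_hardy hg (-1) (by norm_num)))]
  simp

/-- With `g = z S^*g + g(0)`, the term `z θ S^*g` has no constant coefficient. -/
lemma fourierCoeff_zero_unimodularMul {θ : L2T} (hθ : IsInner θ) {g : L2T} (hg : g ∈ hardy) :
    fourierCoeff (unimodularMul hθ.unimodular g) 0 = fourierCoeff θ 0 * fourierCoeff g 0 := by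
  conv_lhs => rw [eq_zMul_backwardShift g]
  rw [map_add, map_smul, unimodularMul_zMul, unimodularMul_fourierLp, zMul_zero,
    fourierCoeff_eq_inner, inner_add_right, inner_smul_right, ← fourierCoeff_eq_inner,
    ← fourierCoeff_eq_inner, fourierCoeff_zMul,
    unimodularMul_mem_hardy hθ.unimodular hθ.mem_hardy (backwardShift_mem_hardy hg) _ (by norm_num), zero_add,
    mul_comm]

/-- The projection of the constant `1` onto `K_θ`. -/
lemma one_sub_smul_mem_modelSpace {θ : L2T} (hθ : IsInner θ) :
    (fourierLp 2 0 : L2T) - (starRingEnd ℂ) (fourierCoeff θ 0) • θ ∈ modelSpace θ := by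
  refine (mem_modelSpace_iff hθ.unimodular).mpr
    ⟨Submodule.sub_mem _ (fourierLp_mem_hardy le_rfl) (Submodule.smul_mem _ _ hθ.mem_hardy), fun g hg => ?_⟩
  have hθ1 : unimodularMul hθ.unimodular (fourierLp 2 0) = θ := by
    rw [unimodularMul_fourierLp, zMul_zero]
  have h1 : ⟪unimodularMul hθ.unimodular g, θ⟫_ℂ = (starRingEnd ℂ) (fourierCoeff g 0) := by
    rw [fourierCoeff_eq_inner, inner_conj_symm, ← (unimodularMul hθ.unimodular).inner_map_map g, hθ1]
  rw [inner_sub_right, inner_smul_right, h1, ← inner_conj_symm, ← fourierCoeff_eq_inner,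
    fourierCoeff_zero_unimodularMul hθ hg, map_mul, sub_self]

/-- If `θ(0) ≠ 0`, then `U_θ` is surjective. -/
lemma dualShift_surjective {θ : L2T} (hθ : IsInner θ) (hθ0 : fourierCoeff θ 0 ≠ 0) :
    Function.Surjective (dualShift θ) := by
  have hc : (starRingEnd ℂ) (fourierCoeff θ 0) ≠ 0 := by simpa using hθ0
  rintro ⟨x, hx⟩
  have hx' := hx
  rw [hθ.orthogonal_modelSpace] at hx'
  obtain ⟨h, hh, y, hy, rfl⟩ := Submodule.mem_sup.mp hx'
  obtain ⟨g, hg, rfl⟩ := (mem_mulSub_iff hθ.unimodular).mp hy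
  have hmem1 : unimodularMul hθ.unimodular (backwardShift g) ∈ (modelSpace θ)ᗮ :=
    mulSub_hardy_le_orthogonal θ
      ((mem_mulSub_iff hθ.unimodular).mpr ⟨_, backwardShift_mem_hardy hg, rfl⟩)
  -- This choice makes `z · (a z̄) = a` equal to `a (1 - \overline{θ(0)} θ) + g(0) θ`: the first
  -- term is in `K_θ`, and the second is what `θ g` still needs beyond `z θ S^*g`.
  set a := fourierCoeff g 0 / (starRingEnd ℂ) (fourierCoeff θ 0) with ha
  refine ⟨⟨zMul (-1) h + (a • fourierLp 2 (-1) + unimodularMul hθ.unimodular (backwardShift g)),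
    Submodule.add_mem _ (conjSub_hardy0_le θ (zMul_mem_conjSub hh (by norm_num)))
      (Submodule.add_mem _ (Submodule.smul_mem _ _
        (conjSub_hardy0_le θ (fourierLp_mem_conjSub (by norm_num)))) hmem1)⟩, ?_⟩
  refine dualShift_eq (Submodule.smul_mem _ a (one_sub_smul_mem_modelSpace hθ)) ?_
  have hg' : unimodularMul hθ.unimodular g =
      zMul 1 (unimodularMul hθ.unimodular (backwardShift g)) + fourierCoeff g 0 • θ := by
    conv_lhs => rw [eq_zMul_backwardShift g]
    rw [map_add, map_smul, unimodularMul_zMul, unimodularMul_fourierLp, zMul_zero]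
  simp only [map_add, map_smul, zMul_zMul, zMul_fourierLp]
  rw [hg', smul_sub, smul_smul, ha, div_mul_cancel₀ _ hc, add_neg_cancel, zMul_zero]
  abel

lemma adjoint_dualShift_of_mem_conjSub {θ h : L2T} (hh : h ∈ conjSub hardy0) :
    ContinuousLinearMap.adjoint (dualShift θ) ⟨h, conjSub_hardy0_le θ hh⟩ =
      ⟨zMul (-1) h, conjSub_hardy0_le θ (zMul_mem_conjSub hh (by norm_num))⟩ :=
  adjoint_dualShift_eq (Submodule.zero_mem _) (add_zero _).symm

/-- Here `z̄ θ g = θ S^*g + g(0) z̄ θ` and `z̄ θ = S^*θ + θ(0) z̄`; the projection removes `S^*θ ∈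
K_θ`. -/
lemma adjoint_dualShift_of_mem_mulSub {θ : L2T} (hθ : IsInner θ) {g : L2T}
    {h : (modelSpace θ)ᗮ} (hg : g ∈ hardy) (hh : (h : L2T) = unimodularMul hθ.unimodular g) :
    (ContinuousLinearMap.adjoint (dualShift θ) h : L2T) =
      unimodularMul hθ.unimodular (backwardShift g) +
        (fourierCoeff g 0 * fourierCoeff θ 0) • fourierLp 2 (-1) := by
  have hmem := Submodule.add_mem _ (mulSub_hardy_le_orthogonal θ
      ((mem_mulSub_iff hθ.unimodular).mpr ⟨_, backwardShift_mem_hardy hg, rfl⟩))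
      (Submodule.smul_mem _ (fourierCoeff g 0 * fourierCoeff θ 0)
        (conjSub_hardy0_le θ (fourierLp_mem_conjSub (n := -1) (by norm_num))))
  rw [adjoint_dualShift_eq (w := ⟨_, hmem⟩)
    (Submodule.smul_mem _ (fourierCoeff g 0) (backwardShift_mem_modelSpace hθ))]
  rw [hh, ← unimodularMul_zMul, zMul_neg_one_eq g, map_add, map_smul, unimodularMul_fourierLp,
    zMul_neg_one_eq θ, smul_add, smul_smul]
  exact (add_assoc _ _ _).symm.trans (add_right_comm _ _ _)

/-! ### Invariant subspaces of `\overline{H_0^2}` and of `H²`. -/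

lemma star_eq_compLpL (f : L2T) :
    star f = (Complex.conjCLE : ℂ →L[ℝ] ℂ).compLpL 2 (haarAddCircle : Measure UnitAddCircle) f := by
  refine Lp.ext ?_
  filter_upwards [Lp.coeFn_star f, (Complex.conjCLE : ℂ →L[ℝ] ℂ).coeFn_compLpL f] with t h1 h2
  rw [h1, h2]
  rfl

lemma continuous_star_L2T : Continuous fun f : L2T => star f := by
  simp only [star_eq_compLpL]
  exact ContinuousLinearMap.continuous _

lemma star_zero_L2T : star (0 : L2T) = 0 := by
  rw [star_eq_compLpL, map_zero]

lemma conjSub_hardy0_le_of_zMul_mem {V : Submodule ℂ L2T} (hV : IsClosed (V : Set L2T))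
    (hz : ∀ f ∈ V, zMul (-1) f ∈ V) (h1 : (fourierLp 2 (-1) : L2T) ∈ V) :
    conjSub hardy0 ≤ V := by
  have hpow : ∀ n : ℕ, (fourierLp 2 (-1 - (n : ℤ)) : L2T) ∈ V := by
    intro n
    induction n with
    | zero => simpa using h1
    | succ n ih =>
      have := hz _ ih
      rw [zMul_fourierLp] at this
      convert this using 2
      push_cast
      ring
  refine fun f hf => mem_of_forall_fourierLp_mem hV fun n hn => ?_
  have hn0 : n < 0 := by
    by_contra hc
    exact hn (mem_conjSub_hardy0_iff.mp hf n (by omega))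
  have := hpow (-1 - n).toNat
  rwa [Int.toNat_of_nonneg (by omega), sub_sub_cancel] at this

/-- Every closed nonzero subspace of `\overline{H_0^2}` invariant under multiplication by `z̄` is
`\overline{α H_0^2}` for some inner `α`. -/
lemma exists_eq_conjSub_mulSub {V : Submodule ℂ L2T} (hV : IsClosed (V : Set L2T))
    (hle : V ≤ conjSub hardy0) (hz : ∀ f ∈ V, zMul (-1) f ∈ V) (hne : V ≠ ⊥) :
    ∃ α : L2T, IsInner α ∧ V = conjSub (mulSub α hardy0) := by
  have hstar : ∀ (n : ℤ) (f : L2T), star (zMul n f) = zMul (-n) (star f) := by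
    intro n f
    refine Lp.ext ?_
    filter_upwards [Lp.coeFn_star (zMul n f), Lp.coeFn_star f, coeFn_zMul n f,
      coeFn_zMul (-n) (star f)] with t h1 h2 h3 h4
    rw [h1, h4, h2, Pi.star_apply, Pi.star_apply, h3, fourier_neg, star_mul', starRingEnd_apply]
  -- Beurling's theorem is applied to `{f : \overline{z f} ∈ V}`; the factor `z` moves `H_0^2` down
  -- to `H²`.
  have hmem : ∀ f, f ∈ (conjSub V).comap (zMul 1).toLinearMap ↔ star (zMul 1 f) ∈ V := fun f =>
    mem_conjSub_iff
  have hclosed : IsClosed (((conjSub V).comap (zMul 1).toLinearMap : Submodule ℂ L2T) : Set L2T) := by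
    have : (((conjSub V).comap (zMul 1).toLinearMap : Submodule ℂ L2T) : Set L2T) =
        (fun f => star (zMul 1 f)) ⁻¹' V := Set.ext hmem
    rw [this]
    exact hV.preimage (continuous_star_L2T.comp (zMul 1).continuous)
  have hhardy : (conjSub V).comap (zMul 1).toLinearMap ≤ hardy := by
    intro f hf n hn
    have := mem_conjSub_hardy0_iff.mp (hle ((hmem f).mp hf)) (-(n + 1)) (by omega)
    rwa [fourierCoeff_star, neg_neg, fourierCoeff_zMul, add_sub_cancel_right, map_eq_zero] at this
  have hshift : ∀ f ∈ (conjSub V).comap (zMul 1).toLinearMap,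
      zMul 1 f ∈ (conjSub V).comap (zMul 1).toLinearMap := by
    intro f hf
    rw [hmem] at hf ⊢
    rw [hstar]
    exact hz _ hf
  have hbot : (conjSub V).comap (zMul 1).toLinearMap ≠ ⊥ := by
    intro hbot
    refine hne ((Submodule.eq_bot_iff _).mpr fun f hf => ?_)
    have h1 : zMul (-1) (star f) ∈ (conjSub V).comap (zMul 1).toLinearMap := by
      rwa [hmem, zMul_zMul, add_neg_cancel, zMul_zero, star_star]
    rw [hbot, Submodule.mem_bot, map_eq_zero_iff _ (zMul (-1)).injective] at h1
    rw [← star_star f, h1, star_zero_L2T]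
  obtain ⟨α, hα, h⟩ := exists_isInner_eq_mulSub_hardy hclosed hhardy hshift hbot
  refine ⟨α, hα, ?_⟩
  ext f
  rw [mem_conjSub_iff, mem_mulSub_iff hα.unimodular]
  have h1 : f ∈ V ↔ zMul (-1) (star f) ∈ (conjSub V).comap (zMul 1).toLinearMap := by
    rw [hmem, zMul_zMul, add_neg_cancel, zMul_zero, star_star]
  rw [h1, h, mem_mulSub_iff hα.unimodular]
  constructor
  · rintro ⟨g, hg, h2⟩
    refine ⟨zMul 1 g, fun n hn => ?_, ?_⟩
    · rw [fourierCoeff_zMul]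
      exact hg _ (by omega)
    · rw [unimodularMul_zMul, h2, zMul_zMul, add_neg_cancel, zMul_zero]
  · rintro ⟨g, hg, h2⟩
    refine ⟨zMul (-1) g, fun n hn => ?_, ?_⟩
    · rw [fourierCoeff_zMul]
      exact hg _ (by omega)
    · rw [unimodularMul_zMul, h2]

/-- A closed proper subspace of `H²` invariant under the backward shift is a model space. -/
lemma exists_eq_modelSpace {N : Submodule ℂ L2T} (hN : IsClosed (N : Set L2T)) (hle : N ≤ hardy)
    (hz : ∀ f ∈ N, backwardShift f ∈ N) (hne : N ≠ hardy) :
    ∃ γ : L2T, IsInner γ ∧ N = modelSpace γ := by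
  have : CompleteSpace N := hN.completeSpace_coe
  have hsup := Submodule.sup_orthogonal_inf_of_hasOrthogonalProjection hle
  have hshift : ∀ f ∈ Nᗮ ⊓ hardy, zMul 1 f ∈ Nᗮ ⊓ hardy := by
    refine fun f hf => ⟨(Submodule.mem_orthogonal _ _).mpr fun g hg => ?_,
      zMul_mem_hardy hf.2 (by norm_num)⟩
    -- Since `f ∈ H²` is orthogonal to `z̄`, `⟨g, z f⟩ = ⟨z̄ g, f⟩` reduces to `⟨S^*g, f⟩`.
    have h1 : ⟪(fourierLp 2 (-1) : L2T), f⟫_ℂ = 0 :=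
      (fourierCoeff_eq_inner _ _).symm.trans (hf.2 _ (by norm_num))
    rw [← neg_neg (1 : ℤ), ← inner_zMul_left, zMul_neg_one_eq, inner_add_left, inner_smul_left,
      h1, (Submodule.mem_orthogonal _ _).mp hf.1 _ (hz g hg), mul_zero, add_zero]
  have hbot : Nᗮ ⊓ hardy ≠ ⊥ := by
    intro hbot
    rw [hbot, sup_bot_eq] at hsup
    exact hne hsup
  obtain ⟨γ, hγ, h⟩ := exists_isInner_eq_mulSub_hardy
    ((Submodule.isClosed_orthogonal N).inter (isClosed_coeffVanishBelow 0)) inf_le_right hshift hbot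
  refine ⟨γ, hγ, ?_⟩
  rw [modelSpace, ← h]
  refine le_antisymm (le_inf hle ((Submodule.le_orthogonal_orthogonal N).trans
    (Submodule.orthogonal_le inf_le_left))) fun f hf => ?_
  have hf1 := hf.1
  rw [← hsup] at hf1
  obtain ⟨n, hn, p, hp, rfl⟩ := Submodule.mem_sup.mp hf1
  have hp0 : p = 0 := by
    have h1 : ⟪p, n + p⟫_ℂ = 0 := (Submodule.mem_orthogonal _ _).mp hf.2 p hp
    rw [inner_add_right, (Submodule.mem_orthogonal' _ _).mp hp.1 n hn, zero_add] at h1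
    exact inner_self_eq_zero.mp h1
  rwa [hp0, add_zero]

/-! ### Reduction to the two components. -/

/-- If `θ(0) ≠ 0`, then nearly `U_θ^*`-invariant subspaces are `U_θ^*`-invariant. -/
lemma IsNearlyInvariant.adjoint_dualShift_mem {θ : L2T} (hθ : IsInner θ)
    (hθ0 : fourierCoeff θ 0 ≠ 0) {M : Submodule ℂ L2T}
    (hM : IsNearlyInvariant (ContinuousLinearMap.adjoint (dualShift θ))
      (M.comap (modelSpace θ)ᗮ.subtype)) {f : (modelSpace θ)ᗮ} (hf : (f : L2T) ∈ M) :
    (ContinuousLinearMap.adjoint (dualShift θ) f : L2T) ∈ M := by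
  refine Submodule.mem_comap.mp (hM.2 f (Submodule.mem_comap.mpr hf) ?_)
  rw [ContinuousLinearMap.adjoint_adjoint]
  exact dualShift_surjective hθ hθ0 f

/-- The two components of an element of `A ⊔ B` with respect to a larger direct sum lie in `A`
and `B`. -/
lemma mem_and_mem_of_add_mem_sup {V W A B : Submodule ℂ L2T} (hVW : Disjoint V W) (hA : A ≤ V)
    (hB : B ≤ W) {a b : L2T} (ha : a ∈ V) (hb : b ∈ W) (hab : a + b ∈ A ⊔ B) :
    a ∈ A ∧ b ∈ B := by
  obtain ⟨a', ha', b', hb', h⟩ := Submodule.mem_sup.mp hab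
  have h0 : a - a' = b' - b := by
    rw [sub_eq_sub_iff_add_eq_add, add_comm b', h]
  have h1 : a - a' = 0 := Submodule.disjoint_def.mp hVW _
    (Submodule.sub_mem _ ha (hA ha')) (h0 ▸ Submodule.sub_mem _ (hB hb') hb)
  refine ⟨by rwa [sub_eq_zero.mp h1], ?_⟩
  rw [h1, eq_comm, sub_eq_zero] at h0
  rwa [← h0]

/-- The `n`-th coefficient of `g` is the constant coefficient of its `n`-fold backward shift. -/
lemma eq_bot_of_backwardShift_mem {N : Submodule ℂ L2T} (hN : N ≤ hardy)
    (hz : ∀ g ∈ N, backwardShift g ∈ N) (h0 : ∀ g ∈ N, fourierCoeff g 0 = 0) : N = ⊥ := by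
  refine (Submodule.eq_bot_iff _).mpr fun g hg => eq_zero_of_fourierCoeff fun n => ?_
  rcases lt_or_ge n 0 with hn | hn
  · exact hN hg n hn
  · lift n to ℕ using hn
    induction n generalizing g with
    | zero => exact h0 g hg
    | succ n ih =>
      rw [Nat.cast_succ, ← fourierCoeff_backwardShift (by omega)]
      exact ih _ (hz g hg)

lemma diskFun_zero (f : L2T) : diskFun f 0 = fourierCoeff f 0 := by
  rw [diskFun, tsum_eq_single 0 fun n hn => by rw [zero_pow hn, mul_zero]]
  simp

lemma mulSub_comap_eq {θ : L2T} (hθ : Unimodular θ) {V W : Submodule ℂ L2T}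
    (hW : W ≤ mulSub θ V) : mulSub θ (W.comap (unimodularMul hθ).toLinearMap) = W := by
  ext f
  rw [mem_mulSub_iff hθ]
  constructor
  · rintro ⟨g, hg, rfl⟩
    exact hg
  · intro hf
    obtain ⟨g, -, rfl⟩ := (mem_mulSub_iff hθ).mp (hW hf)
    exact ⟨g, hf, rfl⟩

lemma mem_comap_unimodularMul {θ : L2T} (hθ : Unimodular θ) {W : Submodule ℂ L2T} {g : L2T} :
    g ∈ W.comap (unimodularMul hθ).toLinearMap ↔ unimodularMul hθ g ∈ W :=
  Iff.rfl

lemma comap_unimodularMul_le {θ : L2T} (hθ : Unimodular θ) {V W : Submodule ℂ L2T}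
    (hW : W ≤ mulSub θ V) : W.comap (unimodularMul hθ).toLinearMap ≤ V := by
  intro g hg
  obtain ⟨g', hg', h⟩ := (mem_mulSub_iff hθ).mp (hW hg)
  rwa [← (unimodularMul hθ).injective h]

lemma zMul_mem_of_invariant {θ : L2T} (hθ : IsInner θ) {A B : Submodule ℂ L2T}
    (hinv : ∀ f : (modelSpace θ)ᗮ, (f : L2T) ∈ A ⊔ B →
      (ContinuousLinearMap.adjoint (dualShift θ) f : L2T) ∈ A ⊔ B)
    (hA : A ≤ conjSub hardy0) (hB : B ≤ mulSub θ hardy)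
    {f : L2T} (hf : f ∈ A) : zMul (-1) f ∈ A := by
  have h1 := hinv ⟨f, conjSub_hardy0_le θ (hA hf)⟩ (Submodule.mem_sup_left hf)
  rw [adjoint_dualShift_of_mem_conjSub (hA hf)] at h1
  exact (mem_and_mem_of_add_mem_sup hθ.mulSub_hardy_isOrtho.symm.disjoint hA hB
    (zMul_mem_conjSub (hA hf) (by norm_num)) (Submodule.zero_mem _) (by rwa [add_zero])).1

/-- The adjoint sends `θ g` to a sum with one term in each of `\overline{H_0^2}` and `θH²`; the two
terms must lie in `A` and `B` separately. The `z̄` term is what couples `B` to `A`. -/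
lemma backwardShift_mem_of_invariant {θ : L2T} (hθ : IsInner θ) {A B : Submodule ℂ L2T}
    (hinv : ∀ f : (modelSpace θ)ᗮ, (f : L2T) ∈ A ⊔ B →
      (ContinuousLinearMap.adjoint (dualShift θ) f : L2T) ∈ A ⊔ B)
    (hA : A ≤ conjSub hardy0) (hB : B ≤ mulSub θ hardy)
    {g : L2T} (hg : unimodularMul hθ.unimodular g ∈ B) :
    (fourierCoeff g 0 * fourierCoeff θ 0) • (fourierLp 2 (-1) : L2T) ∈ A ∧
      unimodularMul hθ.unimodular (backwardShift g) ∈ B := by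
  have hg' : g ∈ hardy := comap_unimodularMul_le hθ.unimodular hB hg
  have h1 := hinv ⟨unimodularMul hθ.unimodular g, mulSub_hardy_le_orthogonal θ (hB hg)⟩
    (Submodule.mem_sup_right hg)
  rw [adjoint_dualShift_of_mem_mulSub hθ hg' rfl, add_comm] at h1
  exact mem_and_mem_of_add_mem_sup hθ.mulSub_hardy_isOrtho.symm.disjoint hA hB
    (Submodule.smul_mem _ _ (fourierLp_mem_conjSub (by norm_num)))
    ((mem_mulSub_iff hθ.unimodular).mpr ⟨_, backwardShift_mem_hardy hg', rfl⟩) h1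

end DualShift

end

/-! ### The classification. -/

open DualShift in
theorem corollary2p4 (θ : DualShift.L2T) (hθ : DualShift.IsInner θ)
    (hθ0 : DualShift.diskFun θ 0 ≠ 0)
    (M Mminus Mplus : Submodule ℂ DualShift.L2T)
    (hMle : M ≤ (DualShift.modelSpace θ)ᗮ)
    (hM_ne_bot : M ≠ ⊥) (hM_ne_top : M ≠ (DualShift.modelSpace θ)ᗮ)
    (hM : DualShift.IsNearlyInvariant
      (ContinuousLinearMap.adjoint (DualShift.dualShift θ))
      (M.comap (DualShift.modelSpace θ)ᗮ.subtype))
    (hMminus : Mminus ≤ DualShift.conjSub DualShift.hardy0)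
    (hMminus_closed : IsClosed (Mminus : Set DualShift.L2T))
    (hMplus : Mplus ≤ DualShift.mulSub θ DualShift.hardy)
    (hMplus_closed : IsClosed (Mplus : Set DualShift.L2T))
    (hsum : DualShift.IsOrthSum M Mminus Mplus) :
    (∃ γ : DualShift.L2T, DualShift.IsInner γ ∧
      DualShift.IsOrthSum M (DualShift.mulSub θ (DualShift.modelSpace γ))
        (DualShift.conjSub DualShift.hardy0)) ∨
    (∃ α : DualShift.L2T, DualShift.IsInner α ∧
      M = DualShift.conjSub (DualShift.mulSub α DualShift.hardy0)) := by
  rw [diskFun_zero] at hθ0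
  obtain ⟨-, rfl⟩ := hsum
  have hinv : ∀ f : (modelSpace θ)ᗮ, (f : L2T) ∈ Mminus ⊔ Mplus →
      (ContinuousLinearMap.adjoint (dualShift θ) f : L2T) ∈ Mminus ⊔ Mplus :=
    fun f hf => hM.adjoint_dualShift_mem hθ hθ0 hf
  have hminus : ∀ f ∈ Mminus, zMul (-1) f ∈ Mminus := fun f hf =>
    zMul_mem_of_invariant hθ hinv hMminus hMplus hf
  obtain ⟨N, hN⟩ : ∃ N, N = Mplus.comap (unimodularMul hθ.unimodular).toLinearMap := ⟨_, rfl⟩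
  have hN_le : N ≤ hardy := hN ▸ comap_unimodularMul_le hθ.unimodular hMplus
  have hN_closed : IsClosed (N : Set L2T) :=
    hN ▸ hMplus_closed.preimage (unimodularMul hθ.unimodular).continuous
  have hMplus_eq : mulSub θ N = Mplus := hN ▸ mulSub_comap_eq hθ.unimodular hMplus
  have hplus : ∀ g ∈ N, (fourierCoeff g 0 * fourierCoeff θ 0) • (fourierLp 2 (-1) : L2T) ∈ Mminus ∧
      backwardShift g ∈ N := by
    intro g hg
    rw [hN, mem_comap_unimodularMul] at hg ⊢
    exact backwardShift_mem_of_invariant hθ hinv hMminus hMplus hg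
  -- A single `g ∈ N` with `g(0) ≠ 0` forces `z̄ ∈ Mminus`, since `θ(0) ≠ 0`.
  by_cases hN0 : ∀ g ∈ N, fourierCoeff g 0 = 0
  · right
    have hMplus_bot : Mplus = ⊥ := by
      rw [← hMplus_eq, eq_bot_of_backwardShift_mem hN_le (fun g hg => (hplus g hg).2) hN0,
        mulSub_eq_map hθ.unimodular, Submodule.map_bot]
    rw [hMplus_bot, sup_bot_eq] at hM_ne_bot ⊢
    exact exists_eq_conjSub_mulSub hMminus_closed hMminus hminus hM_ne_bot
  · left
    push Not at hN0
    obtain ⟨g, hg, hg0⟩ := hN0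
    have h1 : (fourierLp 2 (-1) : L2T) ∈ Mminus :=
      (Submodule.smul_mem_iff _ (mul_ne_zero hg0 hθ0)).mp (hplus g hg).1
    have hminus_eq : Mminus = conjSub hardy0 :=
      le_antisymm hMminus (conjSub_hardy0_le_of_zMul_mem hMminus_closed hminus h1)
    obtain ⟨γ, hγ, h⟩ := exists_eq_modelSpace hN_closed hN_le (fun f hf => (hplus f hf).2)
      -- `N = H²` would make both summands maximal, contradicting properness of `M`.
      (fun h => hM_ne_top (by rw [hθ.orthogonal_modelSpace, hminus_eq, ← hMplus_eq, h]))
    refine ⟨γ, hγ, ?_, ?_⟩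
    · rw [← h, hMplus_eq]
      exact hθ.mulSub_hardy_isOrtho.mono_left hMplus
    · rw [← h, hMplus_eq, hminus_eq, sup_comm]
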